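/- Throughout, $(X,d)$ is a metric space, $B(x,r)$ is the closed ball with centre $x$ and radius $r\ge 0$, $d(x,A)=\inf_{a\in A}d(x,a)$ (with $d(x,\emptyset)=\infty$), and $B(A,s)=\{x\in X: d(x,A)\le s\}$. All index sets of families of balls are arbitrary. Definitions. $X$ is hyperconvex if for every family of closed balls $B(x_i,r_i)$ in $X$ with $d(x_i,x_j)\le r_i+r_j$ for all $i,j$ one has $\bigcap_i B(x_i,r_i)\ne\emptyset$. For $A\subset Y\subset X$, $A$ is externally hyperconvex in $Y$ if for every family of balls $B(x_i,r_i)$ with $x_i\in Y$, $d(x_i,A)\le r_i$ and $d(x_i,x_j)\le r_i+r_j$ for all $i,j$ one has $A\cap\bigcap_i B(x_i,r_i)\neq\emptyset$; $A$ is weakly externally hyperconvex in $Y$ if for every $x\in Y$ it is externally hyperconvex in $A\cup\{x\}$. $A$ is uniformly locally weakly externally hyperconvex in $X$ if there is $r>0$ such that for all $x\in A$ the set $A\cap B(x,r)$ is weakly externally hyperconvex in $B(x,r)$. $A$ is a proximinal $1$-Lipschitz retract of $X$ if there is a $1$-Lipschitz map $\rho\colon X\to A$ with $\rho|_A=\mathrm{id}_A$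 and $d(x,\rho(x))=d(x,A)$ for all $x\in X$. A geodesic bicombing on $X$ is a map $\sigma\colon X\times X\times[0,1]\to X$, $\sigma_{xy}(t)=\sigma(x,y,t)$, such that for all $x,y,x',y'\in X$ and $s,t\in[0,1]$: $\sigma_{xy}(0)=x$, $\sigma_{xy}(1)=y$, $d(\sigma_{xy}(s),\sigma_{xy}(t))=|s-t|\,d(x,y)$, $\sigma_{yx}(t)=\sigma_{xy}(1-t)$, and $d(\sigma_{xy}(t),\sigma_{x'y'}(t))\le(1-t)d(x,x')+t\,d(y,y')$. It is convex if $t\mapsto d(\sigma_{xy}(t),\sigma_{x'y'}(t))$ is convex on $[0,1]$ for all $x,y,x',y'$. A set $A$ is $\sigma$-convex if $\sigma_{xy}([0,1])\subset A$ for all $x,y\in A$. A straight line in $X$ is a constant speed geodesic $c\colon[0,1]\to X$ such that $t\mapsto d(z,c(t))$ is convex for every $z\in X$; straight lines in $X$ are unique if any two of them with the same initial point and the same end point coincide. Theorem. Let $X$ be a hyperconvex metric space and let $A\subset X$ be a non-empty subset. Then the following are equivalent: (i) $A$ is weakly externally hyperconvex in $X$. (ii) For all $x\in X$ and all $r\ge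 d(x,A)$, $A\cap B(x,r)$ is weakly externally hyperconvex in $B(x,r)$. (iii) There is some $x\in X$ such that for all $r\ge d(x,A)$, $A\cap B(x,r)$ is weakly externally hyperconvex in $B(x,r)$. (iv) $A$ is weakly externally hyperconvex in $B(A,s)$ for all $s>0$. (v) $A$ is weakly externally hyperconvex in $B(A,s)$ for some $s>0$. (vi) $A$ is a proximinal $1$-Lipschitz retract of $X$. Moreover, if $A$ (with the induced metric) possesses a convex geodesic bicombing, straight lines in $X$ are unique, and $\sigma$ is a convex geodesic bicombing on $X$, then the following is also equivalent to (i)-(vi): (vii) $A$ is $\sigma$-convex and uniformly locally weakly externally hyperconvex in $X$. -/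

import Mathlib

universe u

/-- The subset `A` of a metric space is hyperconvex: any family of closed balls with centres in `A`
and `d(xᵢ, xⱼ) ≤ rᵢ + rⱼ` has a common point in `A`. Arbitrary families can be reindexed by a subset
of `X × ℝ`, so index types in the universe of `X` suffice. -/
def IsHyperconvexSet {X : Type u} [MetricSpace X] (A : Set X) : Prop :=
  ∀ (ι : Type u) (x : ι → X) (r : ι → ℝ), (∀ i, x i ∈ A) → (∀ i, 0 ≤ r i) →
    (∀ i j, dist (x i) (x j) ≤ r i + r j) →
    ∃ a ∈ A, ∀ i, a ∈ Metric.closedBall (x i) (r i)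

/-- The metric space `X` is hyperconvex. -/
def IsHyperconvexSpace (X : Type u) [MetricSpace X] : Prop :=
  IsHyperconvexSet (Set.univ : Set X)

/-- For `A ⊆ Y ⊆ X`: the set `A` is externally hyperconvex in `Y` (with the metric induced by `X`).
The distance to a set is taken in `[0, ∞]`, so that the distance to the empty set is `∞`. -/
def IsExternallyHyperconvexIn {X : Type u} [MetricSpace X] (A Y : Set X) : Prop :=
  ∀ (ι : Type u) (x : ι → X) (r : ι → ℝ), (∀ i, x i ∈ Y) → (∀ i, 0 ≤ r i) →
    (∀ i, Metric.infEDist (x i) A ≤ ENNReal.ofReal (r i)) →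
    (∀ i j, dist (x i) (x j) ≤ r i + r j) →
    ∃ a ∈ A, ∀ i, a ∈ Metric.closedBall (x i) (r i)

/-- For `A ⊆ Y ⊆ X`: the set `A` is weakly externally hyperconvex in `Y`, i.e. for every `x ∈ Y`
it is externally hyperconvex in `A ∪ {x}`. -/
def IsWeaklyExternallyHyperconvexIn {X : Type u} [MetricSpace X] (A Y : Set X) : Prop :=
  ∀ x ∈ Y, IsExternallyHyperconvexIn A (A ∪ {x})

/-- `A` is uniformly locally weakly externally hyperconvex in `X`. -/
def IsUniformlyLocallyWEH {X : Type u} [MetricSpace X] (A : Set X) : Prop :=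
  ∃ r : ℝ, 0 < r ∧ ∀ x ∈ A,
    IsWeaklyExternallyHyperconvexIn (A ∩ Metric.closedBall x r) (Metric.closedBall x r)

/-- `A` is a proximinal 1-Lipschitz retract of `X`: there is a 1-Lipschitz retraction of `X` onto `A`
that sends every point to a nearest point of `A`. (Used for nonempty `A` only.) -/
def IsProximinalLipschitzRetract {X : Type u} [MetricSpace X] (A : Set X) : Prop :=
  ∃ ρ : X → X, LipschitzWith 1 ρ ∧ (∀ x, ρ x ∈ A) ∧ (∀ a ∈ A, ρ a = a) ∧
    ∀ x, dist x (ρ x) = Metric.infDist x A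

/-- A geodesic bicombing: a choice of constant speed geodesics `σ x y : [0,1] → X` from `x` to `y`,
symmetric and satisfying the weak convexity condition. Curves are functions on `ℝ` of which only the
values on `[0,1]` matter. -/
structure IsGeodesicBicombing {X : Type u} [MetricSpace X] (σ : X → X → ℝ → X) : Prop where
  zero : ∀ x y, σ x y 0 = x
  one : ∀ x y, σ x y 1 = y
  geodesic : ∀ x y, ∀ s ∈ Set.Icc (0 : ℝ) 1, ∀ t ∈ Set.Icc (0 : ℝ) 1,
    dist (σ x y s) (σ x y t) = |s - t| * dist x y
  symm : ∀ x y, ∀ t ∈ Set.Icc (0 : ℝ) 1, σ y x t = σ x y (1 - t)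
  conical : ∀ x y x' y', ∀ t ∈ Set.Icc (0 : ℝ) 1,
    dist (σ x y t) (σ x' y' t) ≤ (1 - t) * dist x x' + t * dist y y'

/-- A convex geodesic bicombing. -/
structure IsConvexGeodesicBicombing {X : Type u} [MetricSpace X] (σ : X → X → ℝ → X) : Prop
    extends IsGeodesicBicombing σ where
  convex : ∀ x y x' y', ConvexOn ℝ (Set.Icc (0 : ℝ) 1) fun t => dist (σ x y t) (σ x' y' t)

/-- The curve `c : [0,1] → X` is a straight line: a constant speed geodesic along which the distance
to every point of `X` is convex. -/
structure IsStraightLine {X : Type u} [MetricSpace X] (c : ℝ → X) : Prop where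
  geodesic : ∀ s ∈ Set.Icc (0 : ℝ) 1, ∀ t ∈ Set.Icc (0 : ℝ) 1,
    dist (c s) (c t) = |s - t| * dist (c 0) (c 1)
  convex : ∀ z : X, ConvexOn ℝ (Set.Icc (0 : ℝ) 1) fun t => dist z (c t)

/-- Straight lines in `X` are unique: they are determined by their endpoints. -/
def HasUniqueStraightLines (X : Type u) [MetricSpace X] : Prop :=
  ∀ c c' : ℝ → X, IsStraightLine c → IsStraightLine c' → c 0 = c' 0 → c 1 = c' 1 →
    Set.EqOn c c' (Set.Icc (0 : ℝ) 1)

/-- `A` is `σ`-convex. -/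
def IsBicombingConvex {X : Type u} (σ : X → X → ℝ → X) (A : Set X) : Prop :=
  ∀ x ∈ A, ∀ y ∈ A, ∀ t ∈ Set.Icc (0 : ℝ) 1, σ x y t ∈ A

/-! Every condition is compared with `MeetsBallsAt A x` for all `x`: one ball about `x` together
with balls centred in `A`. The recurring device is to find, by hyperconvexity of `X`, an auxiliary
point near `A` lying in slightly enlarged balls, and then to use the assumption on `A` there to
return to `A` with a smaller error. The errors vanish after finitely many steps or in a geometric
limit, which exists because hyperconvex spaces are complete.

In `exists_mem_two_balls` the auxiliary points stay within `v` of `A`. This gives both the passage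
from a neighbourhood of `A` to all of `X` and the passage to intersections with balls. The return
from such intersections rests on `meetsBallsAt_of_bounded`.

A proximinal retraction allows the distance to `A` to be halved repeatedly without leaving the
enlarged balls. Conversely, `exists_almost_proximinal_map` builds almost nearest-point maps by
transfinite recursion, and these can be made to converge uniformly.

For bicombings, straight lines of `A` remain straight in `X`, so uniqueness forces `σ` to agree with
the bicombing of `A`. Conversely, contracting along `σ` towards a point of `A` brings a bounded
intersection problem into a small ball, where the local hypothesis reduces the error by a fixed
factor. -/

open Metric Filter Topology

/-- A set of closed balls, given by centre and radius, whose members satisfy the pairwise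
distance condition. -/
def CompatibleBalls {X : Type*} [MetricSpace X] (S : Set (X × ℝ)) : Prop :=
  ∀ p ∈ S, ∀ q ∈ S, dist p.1 q.1 ≤ p.2 + q.2

/-- `A` meets every compatible family of balls consisting of balls centred in `A` and one ball
around `x` of radius at least the distance from `x` to `A`. -/
def MeetsBallsAt {X : Type*} [MetricSpace X] (A : Set X) (x : X) : Prop :=
  ∀ S : Set (X × ℝ), CompatibleBalls S → (∀ q ∈ S, q.1 ∈ A) → ∀ u, infDist x A ≤ u →
    (∀ q ∈ S, dist x q.1 ≤ u + q.2) → ∃ a ∈ A, dist x a ≤ u ∧ ∀ q ∈ S, dist q.1 a ≤ q.2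

/-! ### Compatible families of balls, completeness and approximation -/

section Basic

variable {X : Type u} [MetricSpace X] {A : Set X} {S : Set (X × ℝ)}

theorem CompatibleBalls.nonneg (hS : CompatibleBalls S) {q : X × ℝ} (hq : q ∈ S) : 0 ≤ q.2 := by
  have := hS q hq q hq
  rw [dist_self] at this
  linarith

theorem CompatibleBalls.empty : CompatibleBalls (∅ : Set (X × ℝ)) := fun _ h => h.elim

theorem CompatibleBalls.insert (hS : CompatibleBalls S) {x : X} {r : ℝ} (hr : 0 ≤ r)
    (h : ∀ q ∈ S, dist x q.1 ≤ r + q.2) : CompatibleBalls (insert (x, r) S) := by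
  rintro p (rfl | hp) q (rfl | hq)
  · simpa using add_nonneg hr hr
  · exact h q hq
  · rw [dist_comm, add_comm]; exact h p hp
  · exact hS p hp q hq

theorem IsHyperconvexSpace.exists_point (hX : IsHyperconvexSpace X) (hS : CompatibleBalls S) :
    ∃ a, ∀ q ∈ S, dist q.1 a ≤ q.2 := by
  obtain ⟨a, -, ha⟩ := hX S (fun q => q.1.1) (fun q => q.1.2) (fun _ => Set.mem_univ _)
    (fun q => hS.nonneg q.2) (fun p q => hS _ p.2 _ q.2)
  exact ⟨a, fun q hq => by rw [dist_comm]; exact ha ⟨q, hq⟩⟩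

theorem IsHyperconvexSpace.completeSpace (hX : IsHyperconvexSpace X) : CompleteSpace X := by
  refine Metric.complete_of_convergent_controlled_sequences (fun n => (1 / 2 : ℝ) ^ n)
    (fun n => by positivity) fun x hx => ?_
  have hS : CompatibleBalls (Set.range fun n : ℕ => (x n, (1 / 2 : ℝ) ^ n)) := by
    rintro _ ⟨n, rfl⟩ _ ⟨m, rfl⟩
    have hn : (0 : ℝ) < (1 / 2) ^ n := by positivity
    have hm : (0 : ℝ) < (1 / 2) ^ m := by positivity
    rcases le_total n m with h | h
    · have := hx n n m le_rfl h
      simp only at this ⊢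
      linarith
    · have := hx m n m h le_rfl
      simp only at this ⊢
      linarith
  obtain ⟨a, ha⟩ := hX.exists_point hS
  refine ⟨a, tendsto_iff_dist_tendsto_zero.2 ?_⟩
  exact squeeze_zero (fun _ => dist_nonneg) (fun n => ha _ ⟨n, rfl⟩)
    (tendsto_pow_atTop_nhds_zero_of_lt_one (by norm_num) (by norm_num))

theorem IsExternallyHyperconvexIn.nonempty {Y : Set X} (h : IsExternallyHyperconvexIn A Y) :
    A.Nonempty := by
  obtain ⟨a, ha, -⟩ := h PEmpty (fun i => i.elim) (fun i => i.elim) (fun i => i.elim)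
    (fun i => i.elim) (fun i => i.elim) (fun i => i.elim)
  exact ⟨a, ha⟩

theorem infEDist_le_ofReal_iff (hA : A.Nonempty) {x : X} {u : ℝ} (hu : 0 ≤ u) :
    infEDist x A ≤ ENNReal.ofReal u ↔ infDist x A ≤ u := by
  rw [infDist, ENNReal.le_ofReal_iff_toReal_le (infEDist_ne_top hA) hu]

theorem IsExternallyHyperconvexIn.meetsBallsAt {x : X}
    (h : IsExternallyHyperconvexIn A (A ∪ {x})) : MeetsBallsAt A x := by
  intro S hS hSA u hu hxS
  have hA := h.nonempty
  have hu0 : 0 ≤ u := infDist_nonneg.trans hu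
  have hS' := hS.insert hu0 hxS
  obtain ⟨a, haA, ha⟩ := h (Set.Elem (insert (x, u) S)) (fun q => q.1.1) (fun q => q.1.2)
    (by
      rintro ⟨q, rfl | hq⟩
      · exact Or.inr rfl
      · exact Or.inl (hSA q hq))
    (fun q => hS'.nonneg q.2)
    (by
      rintro ⟨q, hq⟩
      rw [infEDist_le_ofReal_iff hA (hS'.nonneg hq)]
      rcases hq with rfl | hq
      · exact hu
      · rw [infDist_zero_of_mem (hSA q hq)]
        exact hS.nonneg hq)
    (fun p q => hS' _ p.2 _ q.2)
  refine ⟨a, haA, ?_, fun q hq => ?_⟩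
  · rw [dist_comm]; exact ha ⟨(x, u), Set.mem_insert _ _⟩
  · rw [dist_comm]; exact ha ⟨q, Set.mem_insert_of_mem _ hq⟩

/-- All balls centred at `x` can be merged into one whose radius is the infimum of their radii. If
there are none, a ball large enough to impose no obstruction is added. -/
theorem MeetsBallsAt.isExternallyHyperconvexIn {x : X} (hA : A.Nonempty)
    (h : MeetsBallsAt A x) : IsExternallyHyperconvexIn A (A ∪ {x}) := by
  intro ι c r hc hr hcA hcc
  have hcA' : ∀ i, infDist (c i) A ≤ r i := fun i =>
    (infEDist_le_ofReal_iff hA (hr i)).1 (hcA i)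
  suffices H : ∃ u, infDist x A ≤ u ∧ (∀ i, c i = x → u ≤ r i) ∧
      ∀ i, c i ∈ A → dist x (c i) ≤ u + r i by
    obtain ⟨u, hu, hu1, hu2⟩ := H
    obtain ⟨a, ha, hxa, haS⟩ := h ((fun i => (c i, r i)) '' {i | c i ∈ A})
      (by rintro _ ⟨i, -, rfl⟩ _ ⟨j, -, rfl⟩; exact hcc i j)
      (by rintro _ ⟨i, hi, rfl⟩; exact hi) u hu
      (by rintro _ ⟨i, hi, rfl⟩; exact hu2 i hi)
    refine ⟨a, ha, fun i => ?_⟩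
    rw [mem_closedBall, dist_comm]
    rcases hc i with hi | hi
    · exact haS _ ⟨i, hi, rfl⟩
    · rw [hi]
      exact hxa.trans (hu1 i hi)
  by_cases hx : ∃ i, c i = x
  · obtain ⟨i₀, hi₀⟩ := hx
    have hne : (r '' {i | c i = x}).Nonempty := ⟨_, i₀, hi₀, rfl⟩
    have hbd : BddBelow (r '' {i | c i = x}) := ⟨0, by rintro _ ⟨i, -, rfl⟩; exact hr i⟩
    refine ⟨sInf (r '' {i | c i = x}), le_csInf hne ?_, fun i hi => csInf_le hbd ⟨i, hi, rfl⟩, ?_⟩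
    · rintro _ ⟨i, hi, rfl⟩
      have := hcA' i
      rwa [show c i = x from hi] at this
    · intro i _
      rw [← sub_le_iff_le_add]
      refine le_csInf hne ?_
      rintro _ ⟨j, hj, rfl⟩
      have := hcc j i
      rw [show c j = x from hj] at this
      linarith
  · push Not at hx
    by_cases hι : Nonempty ι
    · obtain ⟨i₀⟩ := hι
      have hi₀ : c i₀ ∈ A := (hc i₀).resolve_right (hx i₀)
      refine ⟨dist x (c i₀) + r i₀, ?_, fun i hi => absurd hi (hx i), fun i _ => ?_⟩
      · have := infDist_le_dist_of_mem (x := x) hi₀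
        linarith [hr i₀]
      · linarith [dist_triangle x (c i₀) (c i), hcc i₀ i]
    · exact ⟨infDist x A, le_rfl, fun i => (hι ⟨i⟩).elim, fun i => (hι ⟨i⟩).elim⟩

theorem isWeaklyExternallyHyperconvexIn_iff (hA : A.Nonempty) {Y : Set X} :
    IsWeaklyExternallyHyperconvexIn A Y ↔ ∀ x ∈ Y, MeetsBallsAt A x :=
  ⟨fun h x hx => (h x hx).meetsBallsAt, fun h x hx => (h x hx).isExternallyHyperconvexIn hA⟩

theorem MeetsBallsAt.exists_nearest {x : X} (h : MeetsBallsAt A x) :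
    ∃ a ∈ A, dist x a ≤ infDist x A := by
  obtain ⟨a, ha, hxa, -⟩ := h ∅ CompatibleBalls.empty (fun _ h => h.elim) _ le_rfl
    (fun _ h => h.elim)
  exact ⟨a, ha, hxa⟩

theorem isClosed_of_meetsBallsAt (h : ∀ x, infDist x A = 0 → MeetsBallsAt A x) : IsClosed A := by
  refine isClosed_of_closure_subset fun x hx => ?_
  have hx0 : infDist x A = 0 :=
    (mem_closure_iff_infDist_zero (closure_nonempty_iff.1 ⟨x, hx⟩)).1 hx
  obtain ⟨a, ha, hxa⟩ := (h x hx0).exists_nearest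
  rw [hx0, dist_le_zero] at hxa
  rwa [hxa]

theorem infDist_inter_closedBall_le (hA : A.Nonempty) {x z : X} {R : ℝ}
    (hR : dist z x + infDist x A + 1 ≤ R) :
    infDist x (A ∩ closedBall z R) ≤ infDist x A := by
  refine le_of_forall_pos_le_add fun η hη => ?_
  obtain ⟨a, ha, hxa⟩ := (infDist_lt_iff hA).1
    (lt_add_of_pos_right (infDist x A) (lt_min hη one_pos))
  have h1 := min_le_left η 1
  have h2 := min_le_right η 1
  have haR : a ∈ A ∩ closedBall z R := by
    refine ⟨ha, ?_⟩
    rw [mem_closedBall, dist_comm]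
    linarith [dist_triangle z x a]
  exact (infDist_le_dist_of_mem haR).trans (hxa.le.trans (by linarith))

/-- Iterating a step which moves points by geometrically decreasing amounts. -/
theorem exists_limit_of_step [CompleteSpace X] {J : Type*} (P : ℕ → (J → X) → Prop) {C q : ℝ}
    (hq : q < 1) (f₀ : J → X) (h₀ : P 0 f₀)
    (hstep : ∀ n f, P n f → ∃ g, P (n + 1) g ∧ ∀ j, dist (f j) (g j) ≤ C * q ^ n) :
    ∃ (F : ℕ → J → X) (l : J → X), (∀ n, P n (F n)) ∧
      (∀ j, Tendsto (fun n => F n j) atTop (𝓝 (l j))) ∧ ∀ j, dist (f₀ j) (l j) ≤ C / (1 - q) := by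
  choose! s hs using hstep
  let F : ℕ → J → X := fun n => Nat.rec f₀ s n
  have hF : ∀ n, P n (F n) := fun n => by
    induction n with
    | zero => exact h₀
    | succ n ih => exact (hs n _ ih).1
  have hd : ∀ j n, dist (F n j) (F (n + 1) j) ≤ C * q ^ n := fun j n => (hs n _ (hF n)).2 j
  have hc : ∀ j, ∃ l, Tendsto (fun n => F n j) atTop (𝓝 l) := fun j =>
    cauchySeq_tendsto_of_complete (cauchySeq_of_le_geometric q C hq (hd j))
  choose l hl using hc
  exact ⟨F, l, hF, hl, fun j => dist_le_of_le_geometric_of_tendsto₀ q C hq (hd j) (hl j)⟩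

theorem exists_limit_of_step_point [CompleteSpace X] (P : ℕ → X → Prop) {C q : ℝ}
    (hq : q < 1) (x₀ : X) (h₀ : P 0 x₀)
    (hstep : ∀ n x, P n x → ∃ y, P (n + 1) y ∧ dist x y ≤ C * q ^ n) :
    ∃ (F : ℕ → X) (l : X), (∀ n, P n (F n)) ∧ Tendsto F atTop (𝓝 l) ∧
      dist x₀ l ≤ C / (1 - q) := by
  obtain ⟨F, l, hF, hl, hd⟩ := exists_limit_of_step (J := Unit) (fun n f => P n (f ())) hq
    (fun _ => x₀) h₀ (fun n f hf => by
      obtain ⟨y, hy, hxy⟩ := hstep n _ hf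
      exact ⟨fun _ => y, hy, fun _ => hxy⟩)
  exact ⟨fun n => F n (), l (), hF, hl (), hd ()⟩

/-- An approximate solution with error `(1/2)^n` can serve as the centre of one more ball of that
radius. The next solution is then close to it, so the solutions converge. -/
theorem MeetsBallsAt.of_approx [CompleteSpace X] (hAc : IsClosed A) {x : X}
    (h : ∀ S : Set (X × ℝ), CompatibleBalls S → (∀ q ∈ S, q.1 ∈ A) → ∀ u, infDist x A ≤ u →
      (∀ q ∈ S, dist x q.1 ≤ u + q.2) → ∀ η > 0,
      ∃ a ∈ A, dist x a ≤ u + η ∧ ∀ q ∈ S, dist q.1 a ≤ q.2) : MeetsBallsAt A x := by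
  intro S hS hSA u hu hxS
  obtain ⟨a₀, h₀⟩ := h S hS hSA u hu hxS 1 one_pos
  obtain ⟨F, a, hF, hl, -⟩ := exists_limit_of_step_point (C := 1) (q := 1 / 2)
    (fun n a => a ∈ A ∧ dist x a ≤ u + (1 / 2) ^ n ∧ ∀ q ∈ S, dist q.1 a ≤ q.2)
    (by norm_num) a₀ (by simpa using h₀) (by
      rintro n a ⟨ha, hxa, haS⟩
      have hn : (0 : ℝ) < (1 / 2) ^ n := by positivity
      obtain ⟨b, hb, hxb, hbS⟩ := h (insert (a, (1 / 2) ^ n) S)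
        (hS.insert hn.le fun q hq => by rw [dist_comm]; linarith [haS q hq])
        (by rintro q (rfl | hq); exacts [ha, hSA q hq]) u hu
        (by rintro q (rfl | hq); exacts [hxa, hxS q hq]) ((1 / 2) ^ (n + 1)) (by positivity)
      refine ⟨b, ⟨hb, hxb, fun q hq => hbS q (Set.mem_insert_of_mem _ hq)⟩, ?_⟩
      simpa using hbS _ (Set.mem_insert _ _))
  refine ⟨a, hAc.mem_of_tendsto hl (Eventually.of_forall fun n => (hF n).1), ?_, fun q hq => ?_⟩
  · refine le_of_tendsto_of_tendsto' (tendsto_const_nhds.dist hl) ?_ fun n => (hF n).2.1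
    simpa using (tendsto_const_nhds (x := u)).add
      (tendsto_pow_atTop_nhds_zero_of_lt_one (r := (1 / 2 : ℝ)) (by norm_num) (by norm_num))
  · exact le_of_tendsto' (tendsto_const_nhds.dist hl) fun n => (hF n).2.2 q hq

end Basic

/-! ### Neighbourhoods, intersections with balls, and proximinal retracts -/

section Equivalences

variable {X : Type u} [MetricSpace X] {A : Set X} {S : Set (X × ℝ)}

/-- If `A` meets balls at all points within distance `v`, then a point of `A` in two given balls
can be moved inside these balls towards the intersection of a family of balls centred in `A`. -/
theorem exists_mem_two_balls (hX : IsHyperconvexSpace X) {v : ℝ} (hv : 0 ≤ v)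
    (hA : ∀ y, infDist y A ≤ v → MeetsBallsAt A y) {x z : X} {u R : ℝ} (hu : v ≤ u) (hR : v ≤ R)
    (hxz : dist x z ≤ u + R - 2 * v) (hS : CompatibleBalls S) (hSA : ∀ q ∈ S, q.1 ∈ A)
    (hxS : ∀ q ∈ S, dist x q.1 ≤ u + q.2) (hzS : ∀ q ∈ S, dist z q.1 ≤ R + q.2) (n : ℕ) :
    ∀ a ∈ A, dist x a ≤ u → dist z a ≤ R → (∀ q ∈ S, dist q.1 a ≤ q.2 + n * (2 * v)) →
      ∃ b ∈ A, dist x b ≤ u ∧ dist z b ≤ R ∧ ∀ q ∈ S, dist q.1 b ≤ q.2 := by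
  induction n with
  | zero => exact fun a ha hxa hza haS => ⟨a, ha, hxa, hza, by simpa using haS⟩
  | succ n ih =>
    intro a ha hxa hza haS
    have hnv : 0 ≤ n * (2 * v) := by positivity
    have hshift : ∀ m, 0 ≤ m → CompatibleBalls ((fun q : X × ℝ => (q.1, q.2 + m)) '' S) := by
      rintro m hm _ ⟨p, hp, rfl⟩ _ ⟨q, hq, rfl⟩
      have := hS p hp q hq
      simp only
      linarith
    -- A common point `y` of these balls is within `v` of `a`, hence of `A`. The ball of radius `v`
    -- about `y` lies in both given balls, and moving into it lowers the error by `2 * v`.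
    have hT : CompatibleBalls (insert (x, u - v) (insert (z, R - v) (insert (a, v)
        ((fun q : X × ℝ => (q.1, q.2 + (n * (2 * v) + v))) '' S)))) := by
      refine (((hshift _ (by linarith)).insert hv ?_).insert (by linarith) ?_).insert
        (by linarith) ?_
      · rintro _ ⟨q, hq, rfl⟩
        have := haS q hq
        push_cast at this
        rw [dist_comm]
        simp only
        linarith
      · rintro _ (rfl | ⟨q, hq, rfl⟩)
        · simpa using hza
        · have := hzS q hq
          simp only
          linarith
      · rintro _ (rfl | rfl | ⟨q, hq, rfl⟩)
        · simp only
          linarith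
        · simpa using hxa
        · have := hxS q hq
          simp only
          linarith
    obtain ⟨y, hy⟩ := hX.exists_point hT
    simp only [Set.forall_mem_insert, Set.forall_mem_image] at hy
    obtain ⟨hxy, hzy, hay, hyS⟩ := hy
    have hyA : infDist y A ≤ v := (infDist_le_dist_of_mem ha).trans (by rwa [dist_comm])
    obtain ⟨b, hb, hyb, hbS⟩ := hA y hyA _ (hshift (n * (2 * v)) hnv)
      (by rintro _ ⟨q, hq, rfl⟩; exact hSA q hq) v hyA
      (by
        rintro _ ⟨q, hq, rfl⟩
        have := hyS hq
        rw [dist_comm]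
        simp only
        linarith)
    refine ih b hb ?_ ?_ fun q hq => hbS _ ⟨q, hq, rfl⟩
    · linarith [dist_triangle x y b]
    · linarith [dist_triangle z y b]

/-- Far from `A`, the two given balls are both taken about `x`. An almost nearest point has error at
most `2 * u + η`, which finitely many steps of size `2 * s` remove. -/
theorem meetsBallsAt_of_cthickening (hX : IsHyperconvexSpace X) (hne : A.Nonempty) {s : ℝ}
    (hs : 0 < s) (hA : ∀ y, infDist y A ≤ s → MeetsBallsAt A y) (x : X) : MeetsBallsAt A x := by
  have := hX.completeSpace
  have hAc : IsClosed A := isClosed_of_meetsBallsAt fun y hy => hA y (hy.trans_le hs.le)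
  rcases le_or_gt (infDist x A) s with hxs | hxs
  · exact hA x hxs
  refine MeetsBallsAt.of_approx hAc fun S hS hSA u hu hxS η hη => ?_
  obtain ⟨a, ha, hxa⟩ := (infDist_lt_iff hne).1 (hu.trans_lt (lt_add_of_pos_right u hη))
  obtain ⟨n, hn⟩ := exists_nat_ge ((2 * u + η) / (2 * s))
  rw [div_le_iff₀ (by positivity)] at hn
  have hxS' : ∀ q ∈ S, dist x q.1 ≤ u + η + q.2 := fun q hq => by linarith [hxS q hq]
  obtain ⟨b, hb, hxb, -, hbS⟩ := exists_mem_two_balls hX hs.le hA (x := x) (z := x) (u := u + η)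
    (R := u + η) (by linarith) (by linarith) (by rw [dist_self]; linarith) hS hSA hxS' hxS' n a ha
    hxa.le hxa.le fun q hq => by
      have h1 := dist_triangle q.1 x a
      rw [dist_comm q.1 x] at h1
      linarith [hxS q hq]
  exact ⟨b, hb, hxb, hbS⟩

theorem meetsBallsAt_inter_closedBall (hX : IsHyperconvexSpace X)
    (hA : ∀ y, MeetsBallsAt A y) {z : X} {R : ℝ} (hR : infDist z A ≤ R) :
    (A ∩ closedBall z R).Nonempty ∧ ∀ x ∈ closedBall z R, MeetsBallsAt (A ∩ closedBall z R) x := by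
  have := hX.completeSpace
  have hAc : IsClosed A := isClosed_of_meetsBallsAt fun y _ => hA y
  obtain ⟨a₀, ha₀, hza₀⟩ := (hA z).exists_nearest
  have hne : (A ∩ closedBall z R).Nonempty := ⟨a₀, ha₀, by
    rw [mem_closedBall, dist_comm]; exact hza₀.trans hR⟩
  refine ⟨hne, fun x hx => ?_⟩
  rw [mem_closedBall, dist_comm] at hx
  refine MeetsBallsAt.of_approx (hAc.inter isClosed_closedBall) fun S hS hSA u hu hxS η hη => ?_
  have hu0 : 0 ≤ u := infDist_nonneg.trans hu
  obtain ⟨a, ⟨ha, hza⟩, hxa⟩ := (infDist_lt_iff hne).1 (hu.trans_lt (lt_add_of_pos_right u hη))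
  rw [mem_closedBall, dist_comm] at hza
  have hzS : ∀ q ∈ S, dist z q.1 ≤ R := fun q hq => by
    rw [dist_comm]; exact (hSA q hq).2
  rcases (infDist_nonneg.trans hR).eq_or_lt with rfl | hR0
  · obtain rfl := dist_le_zero.1 hza
    refine ⟨z, ⟨ha, by simp⟩, hxa.le, fun q hq => ?_⟩
    rw [dist_comm]
    exact (hzS q hq).trans (hS.nonneg hq)
  -- The bound `2 * v ≤ u + η` makes the shrunken balls about `x` and `z` compatible, as `dist z x ≤
  -- R`. The slack `η` keeps `v` positive even when `u = 0`.
  have hv1 := min_le_left ((u + η) / 2) R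
  have hv2 := min_le_right ((u + η) / 2) R
  have hv : 0 < min ((u + η) / 2) R := lt_min (by linarith) hR0
  generalize min ((u + η) / 2) R = v at hv1 hv2 hv
  obtain ⟨n, hn⟩ := exists_nat_ge ((2 * u + η) / (2 * v))
  rw [div_le_iff₀ (by positivity)] at hn
  obtain ⟨b, hb, hxb, hzb, hbS⟩ := exists_mem_two_balls hX hv.le (fun y _ => hA y) (x := x) (z := z)
    (u := u + η) (R := R) (by linarith) hv2 (by rw [dist_comm]; linarith) hS
    (fun q hq => (hSA q hq).1) (fun q hq => by linarith [hxS q hq])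
    (fun q hq => by linarith [hzS q hq, hS.nonneg hq]) n a ha hxa.le hza fun q hq => by
      have h1 := dist_triangle q.1 x a
      rw [dist_comm q.1 x] at h1
      linarith [hxS q hq]
  exact ⟨b, ⟨hb, by rwa [mem_closedBall, dist_comm]⟩, hxb, hbS⟩

/-- It suffices to consider families of balls with a bounded set of centres. -/
theorem meetsBallsAt_of_bounded (hX : IsHyperconvexSpace X)
    (h : ∀ x, ∀ S : Set (X × ℝ), CompatibleBalls S → (∀ q ∈ S, q.1 ∈ A) →
      (∃ p L, ∀ q ∈ S, dist p q.1 ≤ L) → ∀ u, infDist x A ≤ u → (∀ q ∈ S, dist x q.1 ≤ u + q.2) →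
      ∃ a ∈ A, dist x a ≤ u ∧ ∀ q ∈ S, dist q.1 a ≤ q.2) (x : X) : MeetsBallsAt A x := by
  intro S hS hSA u hu hxS
  have hu0 : 0 ≤ u := infDist_nonneg.trans hu
  obtain ⟨p, hp⟩ := hX.exists_point (hS.insert hu0 hxS)
  simp only [Set.forall_mem_insert] at hp
  obtain ⟨hxp, hp⟩ := hp
  set L := infDist p A with hL
  have hL0 : 0 ≤ L := infDist_nonneg
  -- Each ball is replaced by a smaller one inside it that still contains `p` and has its centre in
  -- `A` within `L` of `p`. Sharing `p` makes the new family compatible.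
  have key : ∀ q ∈ S, ∃ y ∈ A, dist p y ≤ min q.2 L ∧ dist q.1 y ≤ q.2 - min q.2 L := by
    intro q hq
    rcases le_total q.2 L with hqL | hqL
    · refine ⟨q.1, hSA q hq, ?_⟩
      rw [min_eq_left hqL, dist_comm p]
      exact ⟨hp q hq, by simp⟩
    · obtain ⟨y, hy, hpy, hqy⟩ := h p {(q.1, q.2 - L)}
        (by rintro _ rfl _ rfl; simp only [dist_self]; linarith)
        (by rintro _ rfl; exact hSA q hq) ⟨q.1, 0, by rintro _ rfl; simp⟩ L le_rfl
        (by rintro _ rfl; rw [dist_comm]; simpa using hp q hq)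
      rw [min_eq_right hqL]
      exact ⟨y, hy, hpy, hqy _ rfl⟩
  have : Nonempty X := ⟨x⟩
  choose! y hyA hpy hqy using key
  obtain ⟨a, ha, hxa, haS⟩ := h x ((fun q => (y q, min q.2 L)) '' S)
    (by
      rintro _ ⟨q, hq, rfl⟩ _ ⟨q', hq', rfl⟩
      have := dist_triangle_left (y q) (y q') p
      simp only
      linarith [hpy q hq, hpy q' hq'])
    (by rintro _ ⟨q, hq, rfl⟩; exact hyA q hq)
    ⟨p, L, by rintro _ ⟨q, hq, rfl⟩; exact (hpy q hq).trans (min_le_right _ _)⟩ u hu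
    (by
      rintro _ ⟨q, hq, rfl⟩
      have := dist_triangle x p (y q)
      simp only
      linarith [hpy q hq])
  refine ⟨a, ha, hxa, fun q hq => ?_⟩
  have h1 : dist (y q) a ≤ min q.2 L := haS _ ⟨q, hq, rfl⟩
  linarith [dist_triangle q.1 (y q) a, hqy q hq]

/-- For a bounded family, a large ball about `z` contains `x`, all the centres, and the points of
`A` almost nearest to `x`, so intersecting with it does not increase the distance from `x` to `A`.
-/
theorem meetsBallsAt_of_inter_closedBall (hX : IsHyperconvexSpace X) (hne : A.Nonempty) {z : X}
    (hA : ∀ R, infDist z A ≤ R → ∀ x ∈ closedBall z R, MeetsBallsAt (A ∩ closedBall z R) x)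
    (x : X) : MeetsBallsAt A x := by
  refine meetsBallsAt_of_bounded hX ?_ x
  rintro x S hS hSA ⟨p, L, hpL⟩ u hu hxS
  obtain ⟨R, hR⟩ : ∃ R, R = infDist z A + (dist z x + infDist x A + 1) + (dist z p + |L|) :=
    ⟨_, rfl⟩
  have h1 : 0 ≤ infDist z A := infDist_nonneg
  have h2 : 0 ≤ infDist x A := infDist_nonneg
  have h3 := abs_nonneg L
  have h4 := le_abs_self L
  have h5 : 0 ≤ dist z x := dist_nonneg
  have h6 : 0 ≤ dist z p := dist_nonneg
  obtain ⟨a, ⟨ha, -⟩, hxa, haS⟩ := hA R (by linarith) x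
    (by rw [mem_closedBall, dist_comm]; linarith) S hS
    (fun q hq => ⟨hSA q hq, by
      rw [mem_closedBall, dist_comm]
      linarith [dist_triangle z p q.1, hpL q hq]⟩) u
    ((infDist_inter_closedBall_le hne (by linarith)).trans hu) hxS
  exact ⟨a, ha, hxa, haS⟩

/-- If `y` has error `2 * w`, the balls of radius `w` about `y` and `ρ y` are compatible with the
given balls enlarged by `w`, since `ρ` is 1-Lipschitz and fixes their centres. A common point has
error `w`; the total displacement is at most `u`. -/
theorem IsProximinalLipschitzRetract.meetsBallsAt (hX : IsHyperconvexSpace X)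
    (hA : IsProximinalLipschitzRetract A) (x : X) : MeetsBallsAt A x := by
  have := hX.completeSpace
  obtain ⟨ρ, hρ, hρA, hρid, hρd⟩ := hA
  have hρ' : ∀ x y, dist (ρ x) (ρ y) ≤ dist x y := fun x y => by simpa using hρ.dist_le_mul x y
  intro S hS hSA u hu hxS
  have hu0 : 0 ≤ u := infDist_nonneg.trans hu
  obtain ⟨F, a, hF, hl, hd⟩ := exists_limit_of_step_point (C := u / 2) (q := 1 / 2)
    (fun n y => infDist y A ≤ u * (1 / 2) ^ n ∧ ∀ q ∈ S, dist y q.1 ≤ u * (1 / 2) ^ n + q.2)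
    (by norm_num) x ⟨by simpa using hu, by rw [pow_zero, mul_one]; exact hxS⟩ (by
      rintro n y ⟨hyA, hyS⟩
      obtain ⟨w, hw⟩ : ∃ w, w = u / 2 * (1 / 2) ^ n := ⟨_, rfl⟩
      have hw0 : 0 ≤ w := by rw [hw]; positivity
      have hw2 : u * (1 / 2) ^ n = 2 * w := by rw [hw]; ring
      have hw1 : u * (1 / 2) ^ (n + 1) = w := by rw [hw]; ring
      rw [hw2] at hyA hyS
      rw [hw1, ← hw]
      have hT : CompatibleBalls (insert (y, w) (insert (ρ y, w)
          ((fun q : X × ℝ => (q.1, q.2 + w)) '' S))) := by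
        refine (CompatibleBalls.insert ?_ hw0 ?_).insert hw0 ?_
        · rintro _ ⟨p, hp, rfl⟩ _ ⟨q, hq, rfl⟩
          have := hS p hp q hq
          simp only
          linarith
        · rintro _ ⟨q, hq, rfl⟩
          have := hρ' y q.1
          rw [hρid _ (hSA q hq)] at this
          simp only
          linarith [hyS q hq]
        · rintro _ (rfl | ⟨q, hq, rfl⟩)
          · simp only [hρd]
            linarith
          · simp only
            linarith [hyS q hq]
      obtain ⟨y', hy'⟩ := hX.exists_point hT
      simp only [Set.forall_mem_insert, Set.forall_mem_image] at hy'
      obtain ⟨h1, h2, h3⟩ := hy'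
      refine ⟨y', ⟨(infDist_le_dist_of_mem (hρA y)).trans (by rwa [dist_comm]), fun q hq => ?_⟩, h1⟩
      rw [dist_comm, add_comm]
      exact h3 hq)
  have hpow : Tendsto (fun n : ℕ => u * (1 / 2) ^ n) atTop (𝓝 0) := by
    simpa using (tendsto_pow_atTop_nhds_zero_of_lt_one (r := (1 / 2 : ℝ)) (by norm_num)
      (by norm_num)).const_mul u
  have ha0 : infDist a A ≤ 0 := le_of_tendsto_of_tendsto'
    (((continuous_infDist_pt A).tendsto a).comp hl) hpow fun n => (hF n).1
  have haA : a ∈ A := by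
    have := hρd a
    rw [le_antisymm ha0 infDist_nonneg, dist_eq_zero] at this
    rw [this]
    exact hρA a
  refine ⟨a, haA, hd.trans (by ring_nf; exact le_rfl), fun q hq => ?_⟩
  rw [dist_comm]
  refine le_of_tendsto_of_tendsto' (hl.dist tendsto_const_nhds) ?_ fun n => (hF n).2 q hq
  simpa using hpow.add_const q.2

/-- A 1-Lipschitz map into `A` with almost minimal displacement, close to a given one. -/
theorem exists_almost_proximinal_map (hA : ∀ x, MeetsBallsAt A x) {f : X → X} {c : X → ℝ}
    (hfA : ∀ x, f x ∈ A) (hc : ∀ x, 0 ≤ c x)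
    (hfc : ∀ x y, dist (f x) (f y) + c y ≤ dist x y + c x)
    (hfd : ∀ x, dist x (f x) ≤ infDist x A + c x) {ε : ℝ} (hε : 0 < ε) :
    ∃ g : X → X, (∀ x, g x ∈ A) ∧ (∀ x y, dist (g x) (g y) ≤ dist x y) ∧
      (∀ x, dist x (g x) ≤ infDist x A + ε) ∧ ∀ x, dist (f x) (g x) ≤ c x := by
  -- Distances to `A` are rounded up to multiples of `ε`, so that points can be well-ordered with
  -- `e` nondecreasing. For `y` before `x`, `dist y (g y) ≤ e y ≤ e x` then makes the ball of radius
  -- `e x` about `x` compatible with the one of radius `dist x y` about `g y`.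
  let k : X → ℕ := fun x => ⌈infDist x A / ε⌉₊
  let e : X → ℝ := fun x => k x * ε
  have he1 : ∀ x, infDist x A ≤ e x := fun x => by
    rw [← div_le_iff₀ hε]
    exact Nat.le_ceil _
  have he2 : ∀ x, e x ≤ infDist x A + ε := fun x => by
    have h := (Nat.ceil_lt_add_one (div_nonneg (infDist_nonneg (x := x) (s := A)) hε.le)).le
    calc e x ≤ (infDist x A / ε + 1) * ε := mul_le_mul_of_nonneg_right h hε.le
      _ = infDist x A + ε := by field_simp
  let lt : X → X → Prop := InvImage (Prod.Lex (· < ·) WellOrderingRel) fun x => (k x, x)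
  have hwf : WellFounded lt :=
    InvImage.wf _ (WellFounded.prod_lex (wellFounded_lt (α := ℕ)) WellOrderingRel.isWellOrder.wf)
  have hmono : ∀ {y x}, lt y x → e y ≤ e x := fun {y x} h => by
    have : k y ≤ k x := by
      rcases Prod.lex_def.1 h with h | h
      exacts [h.le, h.1.le]
    simp only [e]
    gcongr
  have htri : ∀ x y, lt x y ∨ x = y ∨ lt y x := fun x y => by
    rcases lt_trichotomy (k x) (k y) with h | h | h
    · exact Or.inl (Prod.lex_def.2 (Or.inl h))
    · rcases trichotomous_of WellOrderingRel x y with h' | h' | h'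
      · exact Or.inl (Prod.lex_def.2 (Or.inr ⟨h, h'⟩))
      · exact Or.inr (Or.inl h')
      · exact Or.inr (Or.inr (Prod.lex_def.2 (Or.inr ⟨h.symm, h'⟩)))
    · exact Or.inr (Or.inr (Prod.lex_def.2 (Or.inl h)))
  let Q : ∀ x, (∀ y, lt y x → X) → X → Prop := fun x prev a =>
    a ∈ A ∧ dist x a ≤ e x ∧ dist (f x) a ≤ c x ∧ ∀ y (h : lt y x), dist (prev y h) a ≤ dist x y
  classical
  -- The fallback value `x` is never taken: `hex` below supplies a valid choice at every stage.
  let step : ∀ x, (∀ y, lt y x → X) → X := fun x prev =>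
    if h : ∃ a, Q x prev a then h.choose else x
  let g : X → X := hwf.fix step
  have hg : ∀ x, Q x (fun y _ => g y) (g x) := by
    intro x
    induction x using hwf.induction with
    | _ x ih =>
      have hgx : g x = step x fun y _ => g y := hwf.fix_eq step x
      have hex : ∃ a, Q x (fun y _ => g y) a := by
        obtain ⟨a, ha, hxa, haS⟩ := hA x
          (insert (f x, c x) ((fun y => (g y, dist x y)) '' {y | lt y x}))
          (by
            refine CompatibleBalls.insert ?_ (hc x) ?_
            · rintro _ ⟨y, hy, rfl⟩ _ ⟨y', hy', rfl⟩
              have h3 := dist_triangle_left y y' x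
              simp only
              rcases htri y y' with h | rfl | h
              · have := (ih y' hy').2.2.2 y h
                rw [dist_comm y' y] at this
                linarith
              · rw [dist_self]
                positivity
              · have := (ih y hy).2.2.2 y' h
                rw [dist_comm (g y)]
                linarith
            · rintro _ ⟨y, hy, rfl⟩
              have := (ih y hy).2.2.1
              simp only
              linarith [dist_triangle (f x) (f y) (g y), hfc x y])
          (by
            rintro _ (rfl | ⟨y, hy, rfl⟩)
            exacts [hfA x, (ih y hy).1])
          (e x) (he1 x)
          (by
            rintro _ (rfl | ⟨y, hy, rfl⟩)
            · simp only
              linarith [hfd x, he1 x]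
            · have := (ih y hy).2.1
              have h2 := hmono hy
              simp only
              linarith [dist_triangle x y (g y)])
        exact ⟨a, ha, hxa, haS _ (Set.mem_insert _ _), fun y hy =>
          haS _ (Set.mem_insert_of_mem _ ⟨y, hy, rfl⟩)⟩
      rw [hgx]
      simp only [step, dif_pos hex]
      exact hex.choose_spec
  refine ⟨g, fun x => (hg x).1, fun x y => ?_, fun x => (hg x).2.1.trans (he2 x),
    fun x => (hg x).2.2.1⟩
  rcases htri x y with h | rfl | h
  · rw [dist_comm x y]
    exact (hg y).2.2.2 x h
  · simp
  · rw [dist_comm (g x)]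
    exact (hg x).2.2.2 y h

/-- The first map comes from a constant map with `c x = dist x a₀`. Later maps use constant `c`, so
successive ones are uniformly `(1/2)^n`-close; the limit has exactly minimal displacement and
therefore fixes `A`. -/
theorem isProximinalLipschitzRetract_of_meetsBallsAt [CompleteSpace X] (hne : A.Nonempty)
    (hA : ∀ x, MeetsBallsAt A x) : IsProximinalLipschitzRetract A := by
  have hAc : IsClosed A := isClosed_of_meetsBallsAt fun y _ => hA y
  obtain ⟨a₀, ha₀⟩ := hne
  obtain ⟨f₀, hf₀A, hf₀L, hf₀d, -⟩ := exists_almost_proximinal_map hA (f := fun _ => a₀)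
    (c := fun x => dist x a₀) (fun _ => ha₀) (fun _ => dist_nonneg)
    (fun x y => by
      rw [dist_self, zero_add, dist_comm x y]
      exact dist_triangle y x a₀)
    (fun x => by linarith [infDist_nonneg (x := x) (s := A)]) one_pos
  obtain ⟨F, ρ, hF, hl, -⟩ := exists_limit_of_step (C := 1) (q := 1 / 2)
    (fun n (f : X → X) => (∀ x, f x ∈ A) ∧ (∀ x y, dist (f x) (f y) ≤ dist x y) ∧
      ∀ x, dist x (f x) ≤ infDist x A + (1 / 2) ^ n) (by norm_num) f₀
    ⟨hf₀A, hf₀L, by simpa using hf₀d⟩ (by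
      rintro n f ⟨h1, h2, h3⟩
      obtain ⟨g, g1, g2, g3, g4⟩ := exists_almost_proximinal_map hA
        (c := fun _ => (1 / 2) ^ n) h1 (fun _ => by positivity)
        (fun x y => by linarith [h2 x y]) h3 (ε := (1 / 2) ^ (n + 1)) (by positivity)
      exact ⟨g, ⟨g1, g2, g3⟩, by simpa using g4⟩)
  have hρA : ∀ x, ρ x ∈ A := fun x =>
    hAc.mem_of_tendsto (hl x) (Eventually.of_forall fun n => (hF n).1 x)
  have hρd : ∀ x, dist x (ρ x) = infDist x A := fun x => by
    refine le_antisymm ?_ (infDist_le_dist_of_mem (hρA x))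
    refine le_of_tendsto_of_tendsto' (tendsto_const_nhds.dist (hl x)) ?_ fun n => (hF n).2.2 x
    simpa using (tendsto_const_nhds (x := infDist x A)).add
      (tendsto_pow_atTop_nhds_zero_of_lt_one (r := (1 / 2 : ℝ)) (by norm_num) (by norm_num))
  refine ⟨ρ, LipschitzWith.of_dist_le_mul fun x y => ?_, hρA, fun a ha => ?_, hρd⟩
  · rw [NNReal.coe_one, one_mul]
    exact le_of_tendsto' ((hl x).dist (hl y)) fun n => (hF n).2.1 x y
  · have := hρd a
    rw [infDist_zero_of_mem ha, dist_eq_zero] at this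
    exact this.symm

end Equivalences

/-! ### Straight lines, convex bicombings and the local-to-global principle -/

section Bicombings

variable {X : Type u} [MetricSpace X] {A : Set X}

theorem IsGeodesicBicombing.const {σ : X → X → ℝ → X} (hσ : IsGeodesicBicombing σ) (x : X)
    {t : ℝ} (ht : t ∈ Set.Icc (0 : ℝ) 1) : σ x x t = x := by
  have := hσ.geodesic x x t ht 0 ⟨le_rfl, zero_le_one⟩
  rwa [dist_self, mul_zero, hσ.zero, dist_eq_zero] at this

theorem IsGeodesicBicombing.dist_left {σ : X → X → ℝ → X} (hσ : IsGeodesicBicombing σ) (x y : X)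
    {t : ℝ} (ht : t ∈ Set.Icc (0 : ℝ) 1) : dist x (σ x y t) = t * dist x y := by
  have := hσ.geodesic x y 0 ⟨le_rfl, zero_le_one⟩ t ht
  rwa [hσ.zero, zero_sub, abs_neg, abs_of_nonneg ht.1] at this

theorem IsGeodesicBicombing.dist_right {σ : X → X → ℝ → X} (hσ : IsGeodesicBicombing σ) (x y : X)
    {t : ℝ} (ht : t ∈ Set.Icc (0 : ℝ) 1) : dist y (σ x y t) = (1 - t) * dist x y := by
  have := hσ.geodesic x y 1 ⟨zero_le_one, le_rfl⟩ t ht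
  rwa [hσ.one, abs_of_nonneg (by linarith [ht.2])] at this

theorem IsGeodesicBicombing.dist_le {σ : X → X → ℝ → X} (hσ : IsGeodesicBicombing σ) (x y z : X)
    {t : ℝ} (ht : t ∈ Set.Icc (0 : ℝ) 1) : dist (σ x y t) (σ x z t) ≤ t * dist y z := by
  simpa using hσ.conical x y x z t ht

theorem IsConvexGeodesicBicombing.isStraightLine {σ : X → X → ℝ → X}
    (hσ : IsConvexGeodesicBicombing σ) (x y : X) : IsStraightLine (σ x y) := by
  refine ⟨fun s hs t ht => ?_, fun z => (hσ.convex z z x y).congr fun t ht => ?_⟩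
  · rw [hσ.zero, hσ.one]
    exact hσ.geodesic x y s hs t ht
  · simp only [hσ.const z ht]

/-- If the graph rose above a chord, the difference would have a positive maximum; at its leftmost
maximum point the local midpoint inequality fails. -/
theorem convexOn_Icc_of_local_midpoint {f : ℝ → ℝ} (hf : ContinuousOn f (Set.Icc 0 1))
    (h : ∀ t ∈ Set.Ioo (0 : ℝ) 1, ∃ δ > 0, ∀ h, 0 < h → h < δ →
      2 * f t ≤ f (t - h) + f (t + h)) : ConvexOn ℝ (Set.Icc 0 1) f := by
  refine LinearOrder.convexOn_of_lt (convex_Icc 0 1) fun x hx y hy hxy a b ha hb hab => ?_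
  by_contra! hlt
  simp only [smul_eq_mul] at hlt
  obtain ⟨k, hk⟩ : ∃ k, k * (y - x) = f y - f x :=
    ⟨(f y - f x) / (y - x), div_mul_cancel₀ _ (by linarith)⟩
  let g : ℝ → ℝ := fun s => f s - (f x + k * (s - x))
  have hsub : Set.Icc x y ⊆ Set.Icc 0 1 := Set.Icc_subset_Icc hx.1 hy.2
  have hg : ContinuousOn g (Set.Icc x y) := (hf.mono hsub).sub (by fun_prop)
  have hgx : g x = 0 := by simp [g]
  have hgy : g y = 0 := by simp [g, hk]
  have hb' : b = 1 - a := by linarith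
  have hw : a * x + b * y ∈ Set.Icc x y := by
    constructor <;> subst hb' <;> nlinarith
  have hgw : 0 < g (a * x + b * y) := by
    have h1 : k * (a * x + b * y - x) = b * (f y - f x) := by
      rw [← hk, hb']; ring
    have h2 : a * f x = f x - b * f x := by rw [hb']; ring
    simp only [g, h1]
    linarith
  obtain ⟨s, hs, hmax⟩ := isCompact_Icc.exists_isMaxOn ⟨_, hw⟩ hg
  have hM : 0 < g s := hgw.trans_le (hmax hw)
  have hcl : IsClosed (Set.Icc x y ∩ g ⁻¹' Set.Ici (g s)) :=
    hg.preimage_isClosed_of_isClosed isClosed_Icc isClosed_Ici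
  obtain ⟨m, ⟨hm, hgm⟩, hleast⟩ :=
    (isCompact_Icc.of_isClosed_subset hcl Set.inter_subset_left).exists_isLeast
      ⟨s, hs, le_refl (g s)⟩
  have hgm' : g s ≤ g m := hgm
  have hmx : x < m := lt_of_le_of_ne hm.1 fun e => by rw [← e, hgx] at hgm'; linarith
  have hmy : m < y := lt_of_le_of_ne hm.2 fun e => by rw [e, hgy] at hgm'; linarith
  obtain ⟨δ, hδ, hδf⟩ := h m ⟨hx.1.trans_lt hmx, hmy.trans_le hy.2⟩
  obtain ⟨h, h0, hlt'⟩ := exists_between (lt_min hδ (lt_min (sub_pos.2 hmx) (sub_pos.2 hmy)))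
  obtain ⟨h1, h2, h3⟩ : h < δ ∧ h < m - x ∧ h < y - m := by
    simpa only [lt_min_iff] using hlt'
  have hmid := hδf h h0 h1
  have hr : g (m + h) ≤ g s := hmax (a := m + h) ⟨by linarith, by linarith⟩
  have hl : g (m - h) < g s := by
    by_contra! hge
    have := hleast ⟨⟨by linarith, by linarith⟩, hge⟩
    linarith
  simp only [g] at hr hl hgm'
  linarith

/-- By local midpoint convexity, it suffices to compare `c t` with nearby `c (t ± h)`. If `c t` is
nearest to `z` in `A`, this is immediate. Otherwise some `a ∈ A` satisfies `dist z a ≤ D` and is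
closer than `z` to both `c (t ± h)` by `D`; convexity seen from `a` then transfers to `z`. -/
theorem isStraightLine_of_meetsBallsAt (hA : ∀ x, MeetsBallsAt A x) {c : ℝ → X}
    (hcA : ∀ t ∈ Set.Icc (0 : ℝ) 1, c t ∈ A)
    (hgeo : ∀ s ∈ Set.Icc (0 : ℝ) 1, ∀ t ∈ Set.Icc (0 : ℝ) 1,
      dist (c s) (c t) = |s - t| * dist (c 0) (c 1))
    (hconv : ∀ a ∈ A, ConvexOn ℝ (Set.Icc (0 : ℝ) 1) fun t => dist a (c t)) :
    IsStraightLine c := by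
  refine ⟨hgeo, fun z => convexOn_Icc_of_local_midpoint ?_ fun t ht => ?_⟩
  · have hc : LipschitzOnWith (nndist (c 0) (c 1)) c (Set.Icc 0 1) :=
      LipschitzOnWith.of_dist_le_mul fun s hs t ht => by
        rw [hgeo s hs t ht, coe_nndist, Real.dist_eq, mul_comm]
    exact (continuous_const.dist continuous_id).comp_continuousOn hc.continuousOn
  have hD : ∀ s ∈ Set.Icc (0 : ℝ) 1, infDist z A ≤ dist z (c s) := fun s hs =>
    infDist_le_dist_of_mem (hcA s hs)
  set D := infDist z A with hDdef
  have htI : t ∈ Set.Icc (0 : ℝ) 1 := Set.Ioo_subset_Icc_self ht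
  have hδ0 : 0 < min t (1 - t) := lt_min ht.1 (sub_pos.2 ht.2)
  rcases (hD t htI).eq_or_lt with heq | hlt
  · refine ⟨_, hδ0, fun h h0 hh => ?_⟩
    obtain ⟨h1, h2⟩ := lt_min_iff.1 hh
    linarith [hD (t - h) ⟨by linarith, by linarith [ht.2]⟩,
      hD (t + h) ⟨by linarith [ht.1], by linarith⟩]
  · set l := dist (c 0) (c 1) with hl
    have hl0 : 0 ≤ l := dist_nonneg
    -- This bound gives `2 * h * l ≤ dist z (c t) - D`, which makes the balls about `c (t ± h)`
    -- compatible; the `+ 1` covers `l = 0`.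
    refine ⟨min (min t (1 - t)) ((dist z (c t) - D) / (2 * l + 1)),
      lt_min hδ0 (div_pos (by linarith) (by linarith)), fun h h0 hh => ?_⟩
    obtain ⟨hh, h3⟩ := lt_min_iff.1 hh
    obtain ⟨h1, h2⟩ := lt_min_iff.1 hh
    rw [lt_div_iff₀ (by linarith)] at h3
    have hm1 : t - h ∈ Set.Icc (0 : ℝ) 1 := ⟨by linarith, by linarith [ht.2]⟩
    have hm2 : t + h ∈ Set.Icc (0 : ℝ) 1 := ⟨by linarith [ht.1], by linarith⟩
    have d1 : dist (c (t - h)) (c t) = h * l := by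
      rw [hgeo _ hm1 _ htI, show t - h - t = -h by ring, abs_neg, abs_of_pos h0]
    have d2 : dist (c (t + h)) (c t) = h * l := by
      rw [hgeo _ hm2 _ htI, show t + h - t = h by ring, abs_of_pos h0]
    have d3 : dist (c (t - h)) (c (t + h)) ≤ h * l + h * l :=
      (dist_triangle_right _ _ (c t)).trans (by rw [d1, d2])
    have t1 := dist_triangle z (c (t - h)) (c t)
    have t2 := dist_triangle z (c (t + h)) (c t)
    have hS : CompatibleBalls (insert (c (t - h), dist z (c (t - h)) - D)
        (insert (c (t + h), dist z (c (t + h)) - D) ∅)) := by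
      refine (CompatibleBalls.empty.insert (sub_nonneg.2 (hD _ hm2)) fun _ h => h.elim).insert
        (sub_nonneg.2 (hD _ hm1)) ?_
      rintro _ (rfl | h)
      · simp only
        nlinarith
      · exact h.elim
    obtain ⟨a, ha, hza, haS⟩ := hA z _ hS
      (by
        rintro _ (rfl | rfl | h)
        exacts [hcA _ hm1, hcA _ hm2, h.elim]) D le_rfl
      (by
        rintro _ (rfl | rfl | h)
        · simp
        · simp
        · exact h.elim)
    simp only [Set.forall_mem_insert] at haS
    obtain ⟨ha1, ha2, -⟩ := haS
    have hmid := (hconv a ha).2 hm1 hm2 one_half_pos.le one_half_pos.le (add_halves (1 : ℝ))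
    simp only [smul_eq_mul] at hmid
    rw [show 1 / 2 * (t - h) + 1 / 2 * (t + h) = t by ring, dist_comm a (c (t - h)),
      dist_comm a (c (t + h))] at hmid
    linarith [dist_triangle z a (c t)]

theorem isBicombingConvex_of_meetsBallsAt (hA : ∀ x, MeetsBallsAt A x)
    (hlines : HasUniqueStraightLines X) {τ : A → A → ℝ → A} (hτ : IsConvexGeodesicBicombing τ)
    {σ : X → X → ℝ → X} (hσ : IsConvexGeodesicBicombing σ) : IsBicombingConvex σ A := by
  intro x hx y hy t ht
  have hline : IsStraightLine fun t => (τ ⟨x, hx⟩ ⟨y, hy⟩ t : X) := by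
    have h := hτ.isStraightLine ⟨x, hx⟩ ⟨y, hy⟩
    exact isStraightLine_of_meetsBallsAt hA (fun t _ => Subtype.coe_prop _) h.geodesic
      fun a ha => h.convex ⟨a, ha⟩
  have := hlines _ _ (hσ.isStraightLine x y) hline (by simp only [hσ.zero, hτ.zero])
    (by simp only [hσ.one, hτ.one]) ht
  rw [this]
  exact Subtype.coe_prop _

theorem meetsBallsAt_of_local (hX : IsHyperconvexSpace X) (hne : A.Nonempty)
    {σ : X → X → ℝ → X} (hσ : IsGeodesicBicombing σ) (hσA : IsBicombingConvex σ A) {r : ℝ}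
    (hr : 0 < r)
    (hA : ∀ a ∈ A, ∀ x ∈ closedBall a r, MeetsBallsAt (A ∩ closedBall a r) x) (x : X) :
    MeetsBallsAt A x := by
  have := hX.completeSpace
  have hAc : IsClosed A := by
    refine isClosed_of_closure_subset fun x hx => ?_
    obtain ⟨a, ha, hxa⟩ := Metric.mem_closure_iff.1 hx r hr
    have hxa' : x ∈ ball a r := hxa
    have hx' : x ∈ closure (A ∩ closedBall a r) := by
      refine closure_mono (Set.inter_subset_inter_right A ball_subset_closedBall) ?_
      rw [Set.inter_comm]
      exact isOpen_ball.inter_closure ⟨hxa', hx⟩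
    have h0 : infDist x (A ∩ closedBall a r) = 0 :=
      (mem_closure_iff_infDist_zero (closure_nonempty_iff.1 ⟨x, hx'⟩)).1 hx'
    obtain ⟨b, hb, hxb⟩ := (hA a ha x (ball_subset_closedBall hxa')).exists_nearest
    rw [h0, dist_le_zero] at hxb
    rw [hxb]
    exact hb.1
  refine meetsBallsAt_of_bounded hX ?_ x
  rintro x S hS hSA ⟨p, L, hpL⟩ u hu hxS
  have hu0 : 0 ≤ u := infDist_nonneg.trans hu
  obtain ⟨a₀, ha₀⟩ := hne
  obtain ⟨m, hm⟩ : ∃ m, m = dist x a₀ + (dist p a₀ + |L|) := ⟨_, rfl⟩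
  have hxa₀ : dist x a₀ ≤ m := by linarith [dist_nonneg (x := p) (y := a₀), abs_nonneg L]
  have hSa₀ : ∀ q ∈ S, dist q.1 a₀ ≤ m := fun q hq => by
    linarith [dist_triangle_left q.1 a₀ p, hpL q hq, le_abs_self L,
      dist_nonneg (x := x) (y := a₀)]
  have hm0 : 0 ≤ m := dist_nonneg.trans hxa₀
  -- The iterates stay within `m` of `a₀`, so `x` and all centres stay within `2 * m` of them. One
  -- factor `t` therefore brings every contracted configuration into a ball of radius `r`.
  obtain ⟨t, ht0, ht1, htr⟩ : ∃ t : ℝ, 0 < t ∧ t ≤ 1 ∧ t * (2 * m + u + 1) ≤ r := by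
    have hpos : 0 < 2 * m + u + 1 := by linarith
    refine ⟨min 1 (r / (2 * m + u + 1)), lt_min one_pos (div_pos hr hpos), min_le_left _ _, ?_⟩
    rw [← le_div_iff₀ hpos]
    exact min_le_right _ _
  have ht : t ∈ Set.Icc (0 : ℝ) 1 := ⟨ht0.le, ht1⟩
  have htd : ∀ d, d ≤ 2 * m + u + 1 → t * d ≤ r := fun d hd =>
    (mul_le_mul_of_nonneg_left hd ht0.le).trans htr
  obtain ⟨F, a, hF, hl, -⟩ := exists_limit_of_step_point (C := t * m) (q := 1 - t)
    (fun n a => a ∈ A ∧ dist a₀ a ≤ m - m * (1 - t) ^ n ∧ dist x a ≤ u + m * (1 - t) ^ n ∧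
      ∀ q ∈ S, dist q.1 a ≤ q.2 + m * (1 - t) ^ n) (by linarith) a₀
    ⟨ha₀, by simp, by rw [pow_zero]; linarith, fun q hq => by
      rw [pow_zero]; linarith [hSa₀ q hq, hS.nonneg hq]⟩ (by
      rintro n a ⟨ha, h1, h2, h3⟩
      obtain ⟨μ, hμ⟩ : ∃ μ, μ = m * (1 - t) ^ n := ⟨_, rfl⟩
      have hμ0 : 0 ≤ μ := by
        rw [hμ]
        exact mul_nonneg hm0 (pow_nonneg (by linarith) n)
      have hμ1 : m * (1 - t) ^ (n + 1) = μ - t * μ := by rw [hμ]; ring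
      have hμ2 : t * m * (1 - t) ^ n = t * μ := by rw [hμ]; ring
      rw [← hμ] at h1 h2 h3
      rw [hμ1, hμ2]
      have hax : dist a x ≤ 2 * m := by
        linarith [dist_triangle_left a x a₀, dist_comm a₀ x]
      have haS : ∀ q ∈ S, dist a q.1 ≤ 2 * m := fun q hq => by
        linarith [dist_triangle_left a q.1 a₀, dist_comm a₀ q.1, hSa₀ q hq]
      have htμ : 0 ≤ t * μ := mul_nonneg ht0.le hμ0
      have htu : infDist (σ a x t) (A ∩ closedBall a r) ≤ t * u := by
        refine le_of_forall_pos_le_add fun η hη => ?_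
        obtain ⟨b, hb, hxb⟩ := (infDist_lt_iff ⟨a₀, ha₀⟩).1
          (hu.trans_lt (lt_add_of_pos_right u (lt_min hη one_pos)))
        have hη1 := min_le_left η 1
        have hη2 := min_le_right η 1
        have hmem : σ a b t ∈ A ∩ closedBall a r := by
          refine ⟨hσA a ha b hb t ht, ?_⟩
          rw [mem_closedBall, dist_comm, hσ.dist_left a b ht]
          exact htd _ (by linarith [dist_triangle a x b])
        calc infDist (σ a x t) (A ∩ closedBall a r) ≤ dist (σ a x t) (σ a b t) :=
              infDist_le_dist_of_mem hmem
          _ ≤ t * dist x b := hσ.dist_le a x b ht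
          _ ≤ t * (u + η) := by gcongr; linarith
          _ = t * u + t * η := by ring
          _ ≤ t * u + η := by gcongr; exact mul_le_of_le_one_left hη.le ht1
      -- The balls contracted by `t` towards `a` are met inside `closedBall a r`, and the extra ball
      -- about `a` bounds the displacement by `t * μ`. Undoing the contraction leaves the error `(1
      -- - t) * μ` for the original balls.
      obtain ⟨b, ⟨hbA, -⟩, hxb, hbS⟩ := hA a ha (σ a x t)
        (by
          rw [mem_closedBall, dist_comm, hσ.dist_left a x ht]
          exact htd _ (by linarith))
        (insert (a, t * μ) ((fun q : X × ℝ => (σ a q.1 t, t * q.2)) '' S))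
        (by
          refine CompatibleBalls.insert ?_ htμ ?_
          · rintro _ ⟨p, hp, rfl⟩ _ ⟨q, hq, rfl⟩
            have := mul_le_mul_of_nonneg_left (hS p hp q hq) ht0.le
            simp only
            linarith [hσ.dist_le a p.1 q.1 ht]
          · rintro _ ⟨q, hq, rfl⟩
            have := mul_le_mul_of_nonneg_left (h3 q hq) ht0.le
            simp only [hσ.dist_left a q.1 ht, dist_comm a q.1]
            linarith)
        (by
          rintro _ (rfl | ⟨q, hq, rfl⟩)
          · exact ⟨ha, mem_closedBall_self hr.le⟩
          · refine ⟨hσA a ha _ (hSA q hq) t ht, ?_⟩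
            rw [mem_closedBall, dist_comm, hσ.dist_left a q.1 ht]
            exact htd _ (by linarith [haS q hq]))
        (t * u) htu
        (by
          rintro _ (rfl | ⟨q, hq, rfl⟩)
          · have := mul_le_mul_of_nonneg_left h2 ht0.le
            rw [dist_comm, hσ.dist_left a x ht, dist_comm]
            linarith
          · have := mul_le_mul_of_nonneg_left (hxS q hq) ht0.le
            simp only
            linarith [hσ.dist_le a x q.1 ht])
      simp only [Set.forall_mem_insert, Set.forall_mem_image] at hbS
      obtain ⟨hab, hbS⟩ := hbS
      have ht1' : 0 ≤ 1 - t := by linarith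
      refine ⟨b, ⟨hbA, ?_, ?_, fun q hq => ?_⟩, hab⟩
      · linarith [dist_triangle a₀ a b]
      · have e1 := hσ.dist_right a x ht
        have e2 := mul_le_mul_of_nonneg_left h2 ht1'
        rw [dist_comm a x] at e1
        linarith [dist_triangle x (σ a x t) b]
      · have e1 := hσ.dist_right a q.1 ht
        have e2 := mul_le_mul_of_nonneg_left (h3 q hq) ht1'
        rw [dist_comm a q.1] at e1
        linarith [dist_triangle q.1 (σ a q.1 t) b, hbS hq])
  have hpow : Tendsto (fun n : ℕ => m * (1 - t) ^ n) atTop (𝓝 0) := by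
    simpa using (tendsto_pow_atTop_nhds_zero_of_lt_one (r := 1 - t) (by linarith)
      (by linarith)).const_mul m
  refine ⟨a, hAc.mem_of_tendsto hl (Eventually.of_forall fun n => (hF n).1), ?_, fun q hq => ?_⟩
  · refine le_of_tendsto_of_tendsto' (tendsto_const_nhds.dist hl) ?_ fun n => (hF n).2.2.1
    simpa using hpow.const_add u
  · refine le_of_tendsto_of_tendsto' (tendsto_const_nhds.dist hl) ?_ fun n => (hF n).2.2.2 q hq
    simpa using hpow.const_add q.2

end Bicombings

theorem mainTheorem7 {X : Type u} [MetricSpace X] (hX : IsHyperconvexSpace X)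
    (A : Set X) (hA : A.Nonempty) :
    List.TFAE [
      IsWeaklyExternallyHyperconvexIn A Set.univ,
      ∀ x : X, ∀ r : ℝ, Metric.infDist x A ≤ r →
        IsWeaklyExternallyHyperconvexIn (A ∩ Metric.closedBall x r) (Metric.closedBall x r),
      ∃ x : X, ∀ r : ℝ, Metric.infDist x A ≤ r →
        IsWeaklyExternallyHyperconvexIn (A ∩ Metric.closedBall x r) (Metric.closedBall x r),
      ∀ s : ℝ, 0 < s → IsWeaklyExternallyHyperconvexIn A (Metric.cthickening s A),
      ∃ s : ℝ, 0 < s ∧ IsWeaklyExternallyHyperconvexIn A (Metric.cthickening s A),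
      IsProximinalLipschitzRetract A] ∧
    ((∃ τ : A → A → ℝ → A, IsConvexGeodesicBicombing τ) → HasUniqueStraightLines X →
      ∀ σ : X → X → ℝ → X, IsConvexGeodesicBicombing σ →
        (IsWeaklyExternallyHyperconvexIn A Set.univ ↔
          (IsBicombingConvex σ A ∧ IsUniformlyLocallyWEH A))) := by
  have hcomplete := hX.completeSpace
  have hiff : IsWeaklyExternallyHyperconvexIn A Set.univ ↔ ∀ x, MeetsBallsAt A x := by
    simp [isWeaklyExternallyHyperconvexIn_iff hA]
  have hball : IsWeaklyExternallyHyperconvexIn A Set.univ → ∀ x : X, ∀ r : ℝ, infDist x A ≤ r →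
      IsWeaklyExternallyHyperconvexIn (A ∩ closedBall x r) (closedBall x r) := by
    intro h x r hr
    obtain ⟨hne, h'⟩ := meetsBallsAt_inter_closedBall hX (hiff.1 h) hr
    exact (isWeaklyExternallyHyperconvexIn_iff hne).2 h'
  refine ⟨?_, ?_⟩
  · tfae_have 1 → 2 := hball
    tfae_have 2 → 3 := fun h => ⟨hA.some, h _⟩
    tfae_have 3 → 1 := by
      rintro ⟨z, hz⟩
      exact hiff.2 (meetsBallsAt_of_inter_closedBall hX hA fun R hR x hx =>
        (hz R hR x hx).meetsBallsAt)
    tfae_have 1 → 4 := fun h s _ x _ => h x (Set.mem_univ x)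
    tfae_have 4 → 5 := fun h => ⟨1, one_pos, h 1 one_pos⟩
    tfae_have 5 → 1 := by
      rintro ⟨s, hs, h⟩
      refine hiff.2 (meetsBallsAt_of_cthickening hX hA hs fun y hy => (h y ?_).meetsBallsAt)
      rw [mem_cthickening_iff]
      exact (infEDist_le_ofReal_iff hA hs.le).2 hy
    tfae_have 1 → 6 := fun h => isProximinalLipschitzRetract_of_meetsBallsAt hA (hiff.1 h)
    tfae_have 6 → 1 := fun h => hiff.2 (h.meetsBallsAt hX)
    tfae_finish
  · rintro ⟨τ, hτ⟩ hlines σ hσ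
    constructor
    · intro h
      refine ⟨isBicombingConvex_of_meetsBallsAt (hiff.1 h) hlines hτ hσ, 1, one_pos, fun x hx => ?_⟩
      exact hball h x 1 (by rw [infDist_zero_of_mem hx]; exact zero_le_one)
    · rintro ⟨hconv, r, hr, h⟩
      exact hiff.2 (meetsBallsAt_of_local hX hA hσ.toIsGeodesicBicombing hconv hr
        fun a ha x hx => (h a ha x hx).meetsBallsAt)
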